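/- Let $V$ be a set with a symmetric weight function $\mu:V\times V\to[0,\infty)$ and a measure $m:V\to(0,\infty)$; write $x\sim y$ if $\mu_{xy}>0$. Assume that the resulting graph $G$ is connected and locally finite, that $\inf_{x\sim y}\mu_{xy}>0$, and that $D_m:=\sup_{x}\deg(x)/m(x)<\infty$, where $\deg(x)=\sum_y\mu_{xy}$. Put $$\Delta f(x)=\frac1{m(x)}\sum_{y}\mu_{xy}(f(y)-f(x)),\qquad \Gamma(f,g)=\tfrac12\big(\Delta(fg)-f\Delta g-g\Delta f\big),$$ $$\Gamma_2(f,g)=\tfrac12\big(\Delta\Gamma(f,g)-\Gamma(f,\Delta g)-\Gamma(\Delta f,g)\big),\qquad \Gamma(f)=\Gamma(f,f),\quad \Gamma_2(f)=\Gamma_2(f,f).$$ Let $n>0$ be a real number and suppose that $G$ satisfies $CDE(n,0)$: for every $x\in V$ and every positive $f:V\to\mathbb R$ with $\Delta f(x)<0$, $$\Gamma_2(f)(x)-\Gamma\Big(f,\frac{\Gamma(f)}{f}\Big)(x)\ \ge\ \frac1n(\Delta f(x))^2 .$$ Let $B_R(x)$ be the ball $\{y: d(x,y)\le R\}$ for the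 combinatorial distance $d$. (1) If $u:V\to\mathbb R$ is harmonic ($\Delta u=0$ on $V$) and has sub-square-root growth, i.e. $\max_{B_R(x)}|u|=o(R^{1/2})$ as $R\to\infty$ for some (equivalently, every) $x\in V$, then $u$ is constant. (2) Suppose in addition that $D_\mu:=\sup_{x\sim y}\deg(x)/\mu_{xy}<\infty$ and that strong cut-off functions exist for all large balls: there is a constant $c>0$ such that for every $x_0\in V$ and all sufficiently large real $R$ (how large may depend on $x_0$) there is $\phi:V\to[0,1]$ with $\phi(x_0)=1$, $\phi=0$ outside $B_R(x_0)$, and for every $x\in B_R(x_0)$ either $\phi(x)<\frac{c}{2R^2}$, or $\phi$ does not vanish at $x$ or at any neighbour of $x$ and $$\phi^2(x)\,\Delta\frac1\phi(x)\le D_m\frac{c}{R^2},\qquad \phi^3(x)\,\Gamma\Big(\frac1\phi\Big)(x)\le D_m\frac{c}{R^2}.$$ Then every harmonic $u:V\to\mathbb R$ of sublinear growth, i.e. $\max_{B_R(x)}|u|=o(R)$ as $R\to\infty$ for some (equivalently, every) $x\in V$, is constant. -/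

import Mathlib

open Filter Asymptotics

noncomputable section

/-- A locally finite, connected weighted graph on the vertex set `V`: the symmetric weight `μ` is
positive exactly on the edges and is bounded below there by a positive constant, and `m` is a
positive measure on the vertices. Loops (`0 < μ x x`) are neither required nor excluded. -/
structure WeightedGraph (V : Type*) where
  /-- the edge weights -/
  μ : V → V → ℝ
  /-- the vertex measure -/
  m : V → ℝ
  μ_nonneg : ∀ x y, 0 ≤ μ x y
  μ_symm : ∀ x y, μ x y = μ y x
  m_pos : ∀ x, 0 < m x
  locallyFinite : ∀ x, {y | 0 < μ x y}.Finite
  connected : (SimpleGraph.fromRel fun x y => 0 < μ x y).Connected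
  μ_min_pos : ∃ δ : ℝ, 0 < δ ∧ ∀ x y, 0 < μ x y → δ ≤ μ x y

namespace WeightedGraph

variable {V : Type*} (G : WeightedGraph V)

/-- The underlying simple graph (loops are irrelevant for distances and connectedness). -/
def toSimpleGraph : SimpleGraph V := SimpleGraph.fromRel fun x y => 0 < G.μ x y

/-- The closed ball of radius `R` around `x` for the combinatorial distance. -/
def ball (x : V) (R : ℝ) : Set V := {y | (G.toSimpleGraph.dist x y : ℝ) ≤ R}

/-- The weighted degree `deg x = ∑ y, μ x y` (a finite sum by local finiteness). -/
def deg (x : V) : ℝ := ∑ᶠ y, G.μ x y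

/-- `D_m < ∞`. -/
def FiniteDm : Prop := BddAbove (Set.range fun x => G.deg x / G.m x)

/-- `D_m = sup_x deg x / m x`. -/
def Dm : ℝ := ⨆ x, G.deg x / G.m x

/-- `D_μ < ∞`, where `D_μ` is the supremum of `deg x / μ x y` over the edges `(x, y)`. -/
def FiniteDμ : Prop := BddAbove {r : ℝ | ∃ x y, 0 < G.μ x y ∧ r = G.deg x / G.μ x y}

/-- The Laplacian `Δ f x = (1 / m x) ∑ y, μ x y (f y - f x)`. -/
def laplacian (f : V → ℝ) (x : V) : ℝ := 1 / G.m x * ∑ᶠ y, G.μ x y * (f y - f x)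

/-- The gradient form `Γ(f, g) = (Δ(fg) - f Δg - (Δf) g) / 2`. -/
def Γ (f g : V → ℝ) (x : V) : ℝ :=
  1 / 2 * (G.laplacian (fun y => f y * g y) x - f x * G.laplacian g x - G.laplacian f x * g x)

/-- The iterated gradient form `Γ₂(f, g) = (Δ Γ(f, g) - Γ(f, Δg) - Γ(Δf, g)) / 2`. -/
def Γ₂ (f g : V → ℝ) (x : V) : ℝ :=
  1 / 2 * (G.laplacian (G.Γ f g) x - G.Γ f (G.laplacian g) x - G.Γ (G.laplacian f) g x)

/-- The exponential curvature dimension inequality `CDE(n, K)`, for a real dimension `n > 0`. -/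
def CDE (n K : ℝ) : Prop :=
  ∀ (x : V) (f : V → ℝ), (∀ y, 0 < f y) → G.laplacian f x < 0 →
    1 / n * (G.laplacian f x) ^ 2 + K * G.Γ f f x
      ≤ G.Γ₂ f f x - G.Γ f (fun y => G.Γ f f y / f y) x

/-- `u` is harmonic on the whole graph. -/
def IsHarmonic (u : V → ℝ) : Prop := ∀ x, G.laplacian u x = 0

/-- `max_{B_R(x)} |u|`; balls are finite, so the supremum is a maximum for `R ≥ 0`. -/
def maxAbs (u : V → ℝ) (x : V) (R : ℝ) : ℝ := sSup ((fun y => |u y|) '' G.ball x R)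

/-- Sub-square-root growth `max_{B_R(x)} |u| = o(R^{1/2})`. By connectedness the condition does not
depend on the base point `x`, so it is required for one of them only. -/
def SubSqrtGrowth (u : V → ℝ) : Prop :=
  ∃ x, (fun R : ℝ => G.maxAbs u x R) =o[atTop] fun R : ℝ => R ^ (1 / 2 : ℝ)

/-- Sublinear growth `max_{B_R(x)} |u| = o(R)`, for one (equivalently, every) base point `x`. -/
def SublinearGrowth (u : V → ℝ) : Prop :=
  ∃ x, (fun R : ℝ => G.maxAbs u x R) =o[atTop] fun R : ℝ => R

/-- `φ` is a `(c, R)`-strong cut-off function centered at `x₀` and supported on `S`, relative to the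
lower curvature bound `-K`. -/
structure IsStrongCutoff (K c R : ℝ) (x₀ : V) (S : Set V) (φ : V → ℝ) : Prop where
  mem_Icc : ∀ x, φ x ∈ Set.Icc (0 : ℝ) 1
  center : φ x₀ = 1
  support : ∀ x, x ∉ S → φ x = 0
  bound : ∀ x ∈ S,
    φ x < c * (1 + R * √K) / (2 * R ^ 2) ∨
    ((φ x ≠ 0 ∧ ∀ y, 0 < G.μ x y → φ y ≠ 0) ∧
      φ x ^ 2 * G.laplacian (fun y => 1 / φ y) x ≤ G.Dm * (c * (1 + R * √K) / R ^ 2) ∧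
      φ x ^ 3 * G.Γ (fun y => 1 / φ y) (fun y => 1 / φ y) x ≤ G.Dm * (c / R ^ 2))

/-- Strong cut-off functions (for curvature bound `K = 0`) exist for all large balls: with a constant
`c` independent of the ball, every `B_R(x₀)` with `R` large enough supports a `(c, R)`-strong cut-off
function centered at `x₀`. -/
def HasStrongCutoffs : Prop :=
  ∃ c : ℝ, 0 < c ∧ ∀ x₀ : V, ∃ R₀ : ℝ, ∀ R : ℝ, R₀ ≤ R →
    ∃ φ : V → ℝ, G.IsStrongCutoff 0 c R x₀ (G.ball x₀ R) φ

end WeightedGraph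

end

namespace WeightedGraph

variable {V : Type*} (G : WeightedGraph V)

/-! A Li–Yau style gradient estimate. If `|u| ≤ M` near `x₀`, put `f = √(u + 2M)`, with `u`
truncated so that `f` is positive on all of `V`, as `CDE` requires. Where `f²` is harmonic, `Δf =
-Γ(f)/f`, so the correction term in `CDE` cancels against `Γ₂` and leaves `(2/n) Γ(f)²/f² ≤ ΔΓ(f)`
(`CDE.le_laplacian_Γ`). At a maximum of `φ Γ(f)` for a cut-off `φ` of error `A`, the upper bound on
`φ² Δ(1/φ)` turns this into `Γ(f)(x₀) ≤ C A M` (`IsCutoff.Γ_sqrtShift_le`), so differences of `u`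
along edges at `x₀` are `O(√A M)`. If `A` is of order `1/g(R)²` and `M = o(g(R))`, these differences
vanish. Linear cut-offs give `g = √R`, strong ones `g = R`. -/

/-! ### Finite-sum formulas and elementary bounds for `Δ` and `Γ`. -/

/-- The finite set of neighbours of a vertex. -/
noncomputable def nbhd (x : V) : Finset V := (G.locallyFinite x).toFinset

variable {G}

theorem mem_nbhd {x y : V} : y ∈ G.nbhd x ↔ 0 < G.μ x y := by
  simp [nbhd]

variable (G)

theorem finsum_μ_mul (x : V) (h : V → ℝ) :
    ∑ᶠ y, G.μ x y * h y = ∑ y ∈ G.nbhd x, G.μ x y * h y := by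
  refine finsum_eq_sum_of_support_subset _ fun y hy => ?_
  have h0 : G.μ x y ≠ 0 := fun h0 => hy (by simp [h0])
  exact mem_nbhd.2 ((G.μ_nonneg x y).lt_of_ne' h0)

theorem deg_eq (x : V) : G.deg x = ∑ y ∈ G.nbhd x, G.μ x y := by
  simpa [deg] using G.finsum_μ_mul x fun _ => 1

theorem laplacian_eq (f : V → ℝ) (x : V) :
    G.laplacian f x = 1 / G.m x * ∑ y ∈ G.nbhd x, G.μ x y * (f y - f x) := by
  rw [laplacian, G.finsum_μ_mul x fun y => f y - f x]

theorem Γ_eq (f g : V → ℝ) (x : V) :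
    G.Γ f g x =
      1 / (2 * G.m x) * ∑ y ∈ G.nbhd x, G.μ x y * ((f y - f x) * (g y - g x)) := by
  have hm := (G.m_pos x).ne'
  have key : ∑ y ∈ G.nbhd x, G.μ x y * ((f y - f x) * (g y - g x)) =
      ∑ y ∈ G.nbhd x, G.μ x y * (f y * g y - f x * g x)
        - f x * ∑ y ∈ G.nbhd x, G.μ x y * (g y - g x)
        - (∑ y ∈ G.nbhd x, G.μ x y * (f y - f x)) * g x := by
    rw [Finset.mul_sum, Finset.sum_mul, ← Finset.sum_sub_distrib, ← Finset.sum_sub_distrib]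
    exact Finset.sum_congr rfl fun y _ => by ring
  rw [key, Γ, laplacian_eq, laplacian_eq, laplacian_eq]
  field_simp

theorem Γ_comm (f g : V → ℝ) (x : V) : G.Γ f g x = G.Γ g f x := by
  simp only [Γ_eq, mul_comm]

theorem Γ_self_nonneg (f : V → ℝ) (x : V) : 0 ≤ G.Γ f f x := by
  rw [Γ_eq]
  have := G.m_pos x
  exact mul_nonneg (by positivity)
    (Finset.sum_nonneg fun y _ => mul_nonneg (G.μ_nonneg x y) (mul_self_nonneg _))

theorem μ_mul_sq_le (f : V → ℝ) (x y : V) (hy : 0 < G.μ x y) :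
    G.μ x y * (f y - f x) ^ 2 ≤ 2 * G.m x * G.Γ f f x := by
  have hm := (G.m_pos x).ne'
  rw [Γ_eq, ← mul_assoc, mul_one_div_cancel (by positivity), one_mul, pow_two]
  exact Finset.single_le_sum (f := fun y => G.μ x y * ((f y - f x) * (f y - f x)))
    (fun z _ => mul_nonneg (G.μ_nonneg x z) (mul_self_nonneg _)) (mem_nbhd.2 hy)

variable {G}

theorem laplacian_congr {f g : V → ℝ} {x : V} (hx : f x = g x)
    (h : ∀ y, 0 < G.μ x y → f y = g y) : G.laplacian f x = G.laplacian g x := by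
  rw [laplacian_eq, laplacian_eq]
  congr 1
  exact Finset.sum_congr rfl fun y hy => by rw [hx, h y (mem_nbhd.1 hy)]

theorem laplacian_mono {f g : V → ℝ} {x : V}
    (h : ∀ y, 0 < G.μ x y → f y - f x ≤ g y - g x) : G.laplacian f x ≤ G.laplacian g x := by
  rw [laplacian_eq, laplacian_eq]
  have := G.m_pos x
  exact mul_le_mul_of_nonneg_left (Finset.sum_le_sum fun y hy =>
    mul_le_mul_of_nonneg_left (h y (mem_nbhd.1 hy)) (G.μ_nonneg x y)) (by positivity)

theorem Γ_congr_neg {f g h : V → ℝ} {x : V} (hx : g x = -h x)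
    (hy : ∀ y, 0 < G.μ x y → g y = -h y) : G.Γ f g x = -G.Γ f h x := by
  rw [Γ_eq, Γ_eq, ← mul_neg, ← Finset.sum_neg_distrib]
  congr 1
  exact Finset.sum_congr rfl fun y h' => by rw [hx, hy y (mem_nbhd.1 h')]; ring

variable (G)

theorem laplacian_add_const (f : V → ℝ) (a : ℝ) (x : V) :
    G.laplacian (fun y => f y + a) x = G.laplacian f x := by
  simp [laplacian_eq]

theorem laplacian_const_mul (f : V → ℝ) (a : ℝ) (x : V) :
    G.laplacian (fun y => a * f y) x = a * G.laplacian f x := by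
  simp only [laplacian_eq, Finset.mul_sum]
  exact Finset.sum_congr rfl fun y _ => by ring

variable {G}

theorem deg_div_le_Dm (hDm : G.FiniteDm) (x : V) : G.deg x / G.m x ≤ G.Dm :=
  le_ciSup hDm x

theorem Dm_nonneg (hDm : G.FiniteDm) (x : V) : 0 ≤ G.Dm :=
  (div_nonneg (by rw [deg_eq]; exact Finset.sum_nonneg fun y _ => G.μ_nonneg x y)
    (G.m_pos x).le).trans (deg_div_le_Dm hDm x)

theorem sum_μ_mul_div_le (hDm : G.FiniteDm) {x : V} {h : V → ℝ} {b : ℝ} (hb : 0 ≤ b)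
    (hh : ∀ y, 0 < G.μ x y → h y ≤ b) :
    1 / G.m x * ∑ y ∈ G.nbhd x, G.μ x y * h y ≤ G.Dm * b := by
  have hm := G.m_pos x
  calc 1 / G.m x * ∑ y ∈ G.nbhd x, G.μ x y * h y
      ≤ 1 / G.m x * ∑ y ∈ G.nbhd x, G.μ x y * b := by
        gcongr with y hy
        · exact G.μ_nonneg x y
        · exact hh y (mem_nbhd.1 hy)
    _ = G.deg x / G.m x * b := by rw [← Finset.sum_mul, ← deg_eq]; ring
    _ ≤ G.Dm * b := by gcongr; exact deg_div_le_Dm hDm x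

theorem laplacian_le_Dm_mul (hDm : G.FiniteDm) {x : V} {f : V → ℝ} {b : ℝ} (hb : 0 ≤ b)
    (hh : ∀ y, 0 < G.μ x y → f y - f x ≤ b) : G.laplacian f x ≤ G.Dm * b := by
  rw [laplacian_eq]
  exact sum_μ_mul_div_le hDm hb hh

theorem Γ_self_le_Dm_mul (hDm : G.FiniteDm) {x : V} {f : V → ℝ} {b : ℝ} (hb : 0 ≤ b)
    (hh : ∀ y, 0 < G.μ x y → (f y - f x) ^ 2 ≤ b) : G.Γ f f x ≤ G.Dm * b := by
  have h1 := sum_μ_mul_div_le hDm hb hh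
  have h2 := G.Γ_self_nonneg f x
  have h3 : G.Γ f f x =
      1 / 2 * (1 / G.m x * ∑ y ∈ G.nbhd x, G.μ x y * (f y - f x) ^ 2) := by
    rw [Γ_eq]; simp only [pow_two]; ring
  linarith

/-! ### The curvature inequality for square roots. -/

/-- If `f²` is harmonic at `x`, then `Δ f = -Γ(f) / f` there. -/
theorem laplacian_eq_neg_Γ_div {f : V → ℝ} {x : V} (hf : f x ≠ 0)
    (h : G.laplacian (fun y => f y * f y) x = 0) : G.laplacian f x = -(G.Γ f f x / f x) := by
  rw [Γ, h]
  field_simp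
  ring

/-- Under `CDE(n, 0)`, the square root `f` of a positive function that is harmonic on the
`1`-neighbourhood of `x` satisfies `(2/n) Γ(f)² / f² ≤ Δ Γ(f)` at `x`. -/
theorem CDE.le_laplacian_Γ {n : ℝ} (hCDE : G.CDE n 0) {f : V → ℝ}
    (hf : ∀ y, 0 < f y) {x : V} (hx : G.laplacian (fun y => f y * f y) x = 0)
    (hy : ∀ y, 0 < G.μ x y → G.laplacian (fun y => f y * f y) y = 0) :
    2 / n * (G.Γ f f x / f x) ^ 2 ≤ G.laplacian (G.Γ f f) x := by
  have hΔ := laplacian_eq_neg_Γ_div (hf x).ne' hx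
  rcases (G.Γ_self_nonneg f x).eq_or_lt with h0 | h0
  -- Here `Δf(x) = 0`, so `CDE` says nothing; but `Γ(f)` attains its minimum at `x`.
  · rw [← h0]
    have : G.laplacian (fun _ : V => (0 : ℝ)) x ≤ G.laplacian (G.Γ f f) x :=
      laplacian_mono fun y _ => by rw [← h0]; simpa using G.Γ_self_nonneg f y
    simpa [laplacian_eq] using this
  · have hneg : G.laplacian f x < 0 := by
      rw [hΔ]; exact neg_neg_of_pos (div_pos h0 (hf x))
    have h1 := hCDE x f hf hneg
    have h2 : G.Γ f (G.laplacian f) x = -G.Γ f (fun y => G.Γ f f y / f y) x :=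
      Γ_congr_neg hΔ fun y hxy => laplacian_eq_neg_Γ_div (hf y).ne' (hy y hxy)
    have h3 : G.Γ₂ f f x - G.Γ f (fun y => G.Γ f f y / f y) x =
        1 / 2 * G.laplacian (G.Γ f f) x := by
      rw [Γ₂, G.Γ_comm (G.laplacian f) f, h2]; ring
    rw [h3, hΔ, neg_sq] at h1
    have h4 : 2 / n * (G.Γ f f x / f x) ^ 2 = 2 * (1 / n * (G.Γ f f x / f x) ^ 2) := by ring
    linarith

/-! ### Distances and balls. -/

theorem dist_le_one {x y : V} (h : 0 < G.μ x y) : G.toSimpleGraph.dist x y ≤ 1 := by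
  by_cases hxy : x = y
  · simp [hxy]
  · have : G.toSimpleGraph.Adj x y := by
      rw [toSimpleGraph, SimpleGraph.fromRel_adj]; exact ⟨hxy, Or.inl h⟩
    exact (SimpleGraph.dist_eq_one_iff_adj.2 this).le

theorem dist_le_add_one (x₀ : V) {x y : V} (h : 0 < G.μ x y) :
    G.toSimpleGraph.dist x₀ y ≤ G.toSimpleGraph.dist x₀ x + 1 :=
  (G.connected.dist_triangle (v := x)).trans (Nat.add_le_add_left (dist_le_one h) _)

theorem mem_ball {x y : V} {R : ℝ} :
    y ∈ G.ball x R ↔ (G.toSimpleGraph.dist x y : ℝ) ≤ R := Iff.rfl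

theorem mem_ball_of_adj {x₀ x y : V} {R : ℝ} (hx : x ∈ G.ball x₀ R) (h : 0 < G.μ x y) :
    y ∈ G.ball x₀ (R + 1) := by
  have h1 : (G.toSimpleGraph.dist x₀ y : ℝ) ≤ G.toSimpleGraph.dist x₀ x + 1 := by
    exact_mod_cast dist_le_add_one x₀ h
  rw [mem_ball] at *
  linarith

variable (G)

theorem ball_finite (x : V) (R : ℝ) : (G.ball x R).Finite := by
  have key : ∀ k : ℕ, {y | G.toSimpleGraph.dist x y ≤ k}.Finite := by
    intro k
    induction k with
    | zero =>
      refine (Set.finite_singleton x).subset fun y hy => ?_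
      exact ((G.connected.dist_eq_zero_iff).1 (Nat.le_zero.1 hy)).symm
    | succ k ih =>
      refine (ih.union (ih.biUnion fun z _ => G.locallyFinite z)).subset fun y hy => ?_
      rcases Nat.lt_or_ge k (G.toSimpleGraph.dist x y) with hlt | hle
      · right
        -- Walking from `y` to `x` makes the first step a neighbour of `y` closer to `x`.
        obtain ⟨p, hp⟩ := G.connected.exists_walk_length_eq_dist y x
        cases p with
        | nil => simp at hlt
        | cons hadj q =>
          rename_i z
          have hz : G.toSimpleGraph.dist x z ≤ k := by
            have h1 := SimpleGraph.dist_le q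
            rw [SimpleGraph.Walk.length_cons] at hp
            rw [SimpleGraph.dist_comm] at h1 hp
            change G.toSimpleGraph.dist x z ≤ _ at h1
            change _ = G.toSimpleGraph.dist x y at hp
            have : G.toSimpleGraph.dist x y ≤ k + 1 := hy
            omega
          have hμ : 0 < G.μ z y := by
            rcases hadj.2 with h | h
            · rwa [G.μ_symm]
            · exact h
          exact Set.mem_biUnion (show z ∈ {y | G.toSimpleGraph.dist x y ≤ k} from hz) hμ
      · exact Or.inl hle
  refine (key ⌊R⌋₊).subset fun y hy => ?_
  exact Nat.le_floor hy

theorem abs_le_maxAbs (u : V → ℝ) {x y : V} {R : ℝ} (hy : y ∈ G.ball x R) :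
    |u y| ≤ G.maxAbs u x R :=
  le_csSup ((G.ball_finite x R).image _).bddAbove ⟨y, hy, rfl⟩

variable {G}

/-! ### The truncated square root. -/

/-- The square root of the truncation of `u` to `[-M, M]`, shifted by `2 M`. -/
noncomputable def sqrtShift (u : V → ℝ) (M : ℝ) (y : V) : ℝ := √(max (-M) (min (u y) M) + 2 * M)

theorem sqrtShift_mul_self_mem (u : V → ℝ) {M : ℝ} (hM : 0 < M) (y : V) :
    sqrtShift u M y * sqrtShift u M y ∈ Set.Icc M (3 * M) := by
  have h1 := le_max_left (-M) (min (u y) M)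
  have h2 : max (-M) (min (u y) M) ≤ M := max_le (by linarith) (min_le_right _ _)
  rw [sqrtShift, Real.mul_self_sqrt (by linarith)]
  constructor <;> linarith

theorem sqrtShift_pos (u : V → ℝ) {M : ℝ} (hM : 0 < M) (y : V) : 0 < sqrtShift u M y := by
  have h1 := le_max_left (-M) (min (u y) M)
  exact Real.sqrt_pos.2 (by linarith)

theorem sqrtShift_mul_self {u : V → ℝ} {M : ℝ} {y : V} (hM : 0 < M) (h : |u y| ≤ M) :
    sqrtShift u M y * sqrtShift u M y = u y + 2 * M := by
  obtain ⟨h1, h2⟩ := abs_le.1 h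
  rw [sqrtShift, min_eq_left h2, max_eq_right h1, Real.mul_self_sqrt (by linarith)]

theorem IsHarmonic.laplacian_sqrtShift {u : V → ℝ} (hu : G.IsHarmonic u) {M : ℝ} (hM : 0 < M)
    {x : V} (hx : |u x| ≤ M) (hy : ∀ y, 0 < G.μ x y → |u y| ≤ M) :
    G.laplacian (fun y => sqrtShift u M y * sqrtShift u M y) x = 0 := by
  rw [← hu x, ← G.laplacian_add_const u (2 * M)]
  exact laplacian_congr (sqrtShift_mul_self hM hx) fun y h => sqrtShift_mul_self hM (hy y h)

/-- Two positive numbers with squares at most `3M` differ by at most `√(3M)`. This crude bound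
suffices where the cut-off is small. -/
theorem Γ_sqrtShift_le (hDm : G.FiniteDm) (u : V → ℝ) {M : ℝ} (hM : 0 < M) (x : V) :
    G.Γ (sqrtShift u M) (sqrtShift u M) x ≤ G.Dm * (3 * M) := by
  refine Γ_self_le_Dm_mul hDm (by positivity) fun y _ => ?_
  have hx := sqrtShift_pos u hM x
  have hy := sqrtShift_pos u hM y
  have hx' := (sqrtShift_mul_self_mem u hM x).2
  have hy' := (sqrtShift_mul_self_mem u hM y).2
  rcases le_total (sqrtShift u M x) (sqrtShift u M y) with h | h <;> nlinarith

/-! ### Maximum principle and gradient estimate. -/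

/-- A cut-off function centred at `x₀` and supported in the ball of radius `R`, with error `A`:
the part of a strong cut-off function that the maximum principle uses. -/
structure IsCutoff (G : WeightedGraph V) (A R : ℝ) (x₀ : V) (φ : V → ℝ) : Prop where
  nonneg : ∀ x, 0 ≤ φ x
  center : φ x₀ = 1
  support : ∀ x, x ∉ G.ball x₀ R → φ x = 0
  bound : ∀ x ∈ G.ball x₀ R, φ x ≤ A ∨
    (0 < φ x ∧ (∀ y, 0 < G.μ x y → 0 < φ y) ∧
      φ x ^ 2 * G.laplacian (fun y => 1 / φ y) x ≤ G.Dm * A)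

/-- At a maximum of `φ w` where `φ` is positive nearby, `Δ w ≤ φ w Δ(1/φ)`. -/
theorem laplacian_le_of_isMax {φ w : V → ℝ} {x : V} (hmax : ∀ y, φ y * w y ≤ φ x * w x)
    (hx : 0 < φ x) (hy : ∀ y, 0 < G.μ x y → 0 < φ y) :
    G.laplacian w x ≤ φ x * w x * G.laplacian (fun y => 1 / φ y) x := by
  rw [← laplacian_const_mul]
  refine laplacian_mono fun y hxy => ?_
  have hφ := hy y hxy
  -- The multiple `φ x * w x` of `1/φ` touches `w` from above at `x`.
  have h1 : w y ≤ φ x * w x * (1 / φ y) := by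
    rw [mul_one_div, le_div_iff₀ hφ, mul_comm]; exact hmax y
  have h2 : φ x * w x * (1 / φ x) = w x := by field_simp
  rw [h2]
  linarith

/-- The local gradient estimate for harmonic functions under `CDE(n, 0)`. -/
theorem IsCutoff.Γ_sqrtShift_le (hDm : G.FiniteDm) {n : ℝ} (hn : 0 < n) (hCDE : G.CDE n 0)
    {u : V → ℝ} (hu : G.IsHarmonic u) {A R M : ℝ} (hA : 0 ≤ A) (hR : 0 ≤ R) (hM : 0 < M)
    {x₀ : V} (hbd : ∀ y ∈ G.ball x₀ (R + 2), |u y| ≤ M) {φ : V → ℝ}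
    (hφ : G.IsCutoff A R x₀ φ) :
    G.Γ (sqrtShift u M) (sqrtShift u M) x₀ ≤ G.Dm * (3 + 3 * n) * (A * M) := by
  set f := sqrtShift u M with hf
  have hD := Dm_nonneg hDm x₀
  have hx₀ : x₀ ∈ G.ball x₀ R := by rw [mem_ball]; simpa using hR
  obtain ⟨x, hx, hmax⟩ := Set.exists_max_image (G.ball x₀ R) (fun y => φ y * G.Γ f f y)
    (G.ball_finite x₀ R) ⟨x₀, hx₀⟩
  have hw := G.Γ_self_nonneg f x
  have hmax' : ∀ y, φ y * G.Γ f f y ≤ φ x * G.Γ f f x := by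
    intro y
    by_cases hy : y ∈ G.ball x₀ R
    · exact hmax y hy
    · rw [hφ.support y hy, zero_mul]
      exact mul_nonneg (hφ.nonneg x) hw
  have h0 : G.Γ f f x₀ ≤ φ x * G.Γ f f x := by
    simpa [hφ.center] using hmax' x₀
  refine h0.trans ?_
  rcases hφ.bound x hx with hsmall | ⟨hpos, hpos', hΔ⟩
  · calc φ x * G.Γ f f x ≤ A * (G.Dm * (3 * M)) :=
          mul_le_mul hsmall (WeightedGraph.Γ_sqrtShift_le hDm u hM x) hw hA
      _ ≤ G.Dm * (3 + 3 * n) * (A * M) := by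
          have : 0 ≤ G.Dm * n * (A * M) := by positivity
          linarith
  · have hb1 : ∀ y, 0 < G.μ x y → y ∈ G.ball x₀ (R + 1) := fun y h => mem_ball_of_adj hx h
    have hmono : ∀ y ∈ G.ball x₀ (R + 1), |u y| ≤ M := fun y hy =>
      hbd y (by rw [mem_ball] at *; linarith)
    have hux : |u x| ≤ M := hmono x (by rw [mem_ball] at *; linarith)
    -- Harmonicity of `f²` at neighbours of `x` involves vertices two steps away, hence the radius
    -- `R + 2`.
    have hlap := hCDE.le_laplacian_Γ (f := f) (sqrtShift_pos u hM) (x := x)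
      (hu.laplacian_sqrtShift hM hux fun y h => hmono y (hb1 y h))
      (fun y h => hu.laplacian_sqrtShift hM (hmono y (hb1 y h)) fun z hz => hbd z (by
        have := mem_ball_of_adj (hb1 y h) hz
        rw [mem_ball] at *; linarith))
    have hle := hlap.trans (laplacian_le_of_isMax hmax' hpos hpos')
    have hfx := sqrtShift_pos u hM x
    have hfx' := (sqrtShift_mul_self_mem u hM x).2
    rw [← hf] at hfx hfx'
    rcases hw.eq_or_lt with hw0 | hw0
    · rw [← hw0, mul_zero]; positivity
    set L := G.laplacian (fun y => 1 / φ y) x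
    set w := G.Γ f f x
    have h1 : 2 * w ≤ n * (f x * f x) * (φ x * L) := by
      have h2 : 2 / n * (w / f x) ^ 2 = (2 * w) * w / (n * (f x * f x)) := by
        field_simp
      rw [h2, div_le_iff₀ (by positivity)] at hle
      exact le_of_mul_le_mul_right (by linarith) hw0
    have h3 : φ x * (2 * w) ≤ n * (f x * f x) * (G.Dm * A) := by
      calc φ x * (2 * w) ≤ φ x * (n * (f x * f x) * (φ x * L)) := by gcongr
        _ = n * (f x * f x) * (φ x ^ 2 * L) := by ring
        _ ≤ n * (f x * f x) * (G.Dm * A) := by gcongr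
    have h4 : n * (f x * f x) * (G.Dm * A) ≤ n * (3 * M) * (G.Dm * A) := by gcongr
    have h5 : 0 ≤ G.Dm * (A * M) := by positivity
    have h6 : 0 ≤ G.Dm * (A * M) * n := by positivity
    linarith

/-- With `a`, `b` the values of the root at `x₀`, `y`, one has `u y - u x₀ = (b - a)(b + a)`: `Γ`
controls the first factor, and `(b + a)² ≤ 2(a² + b²) ≤ 12M`. -/
theorem IsCutoff.μ_mul_sq_le (hDm : G.FiniteDm) {n : ℝ} (hn : 0 < n) (hCDE : G.CDE n 0)
    {u : V → ℝ} (hu : G.IsHarmonic u) {A R M : ℝ} (hA : 0 ≤ A) (hR : 0 ≤ R) (hM : 0 < M)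
    {x₀ : V} (hbd : ∀ y ∈ G.ball x₀ (R + 2), |u y| ≤ M) {φ : V → ℝ}
    (hφ : G.IsCutoff A R x₀ φ) {y : V} (hy : 0 < G.μ x₀ y) :
    G.μ x₀ y * (u y - u x₀) ^ 2 ≤
      24 * G.m x₀ * (G.Dm * (3 + 3 * n)) * (A * M ^ 2) := by
  have hx₀ : x₀ ∈ G.ball x₀ R := by rw [mem_ball]; simpa using hR
  have hux : |u x₀| ≤ M := hbd x₀ (by rw [mem_ball] at *; linarith)
  have huy : |u y| ≤ M := hbd y (by
    have := mem_ball_of_adj hx₀ hy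
    rw [mem_ball] at *; linarith)
  have hΓ := hφ.Γ_sqrtShift_le hDm hn hCDE hu hA hR hM hbd
  have h1 := G.μ_mul_sq_le (sqrtShift u M) x₀ y hy
  have hx3 := (sqrtShift_mul_self_mem u hM x₀).2
  have hy3 := (sqrtShift_mul_self_mem u hM y).2
  have hxe := sqrtShift_mul_self hM hux
  have hye := sqrtShift_mul_self hM huy
  set a := sqrtShift u M x₀
  set b := sqrtShift u M y
  have hm := G.m_pos x₀
  have h2 : u y - u x₀ = (b - a) * (b + a) := by linear_combination hxe - hye
  have h3 : (b + a) ^ 2 ≤ 12 * M := by nlinarith [sq_nonneg (b - a)]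
  calc G.μ x₀ y * (u y - u x₀) ^ 2 = G.μ x₀ y * (b - a) ^ 2 * (b + a) ^ 2 := by
        rw [h2]; ring
    _ ≤ 2 * G.m x₀ * (G.Dm * (3 + 3 * n) * (A * M)) * (12 * M) := by
        refine mul_le_mul (h1.trans ?_) h3 (sq_nonneg _) ?_
        · gcongr
        · exact (mul_nonneg hy.le (sq_nonneg _)).trans (h1.trans (by gcongr))
    _ = _ := by ring

/-! ### The Liouville argument for a general scale. -/

theorem eq_of_forall_adj_eq {u : V → ℝ} (h : ∀ x y, 0 < G.μ x y → u y = u x) (x y : V) :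
    u x = u y := by
  obtain ⟨p⟩ := G.connected.preconnected x y
  induction p with
  | nil => rfl
  | cons hadj _ ih =>
    rw [← ih]
    rcases hadj.2 with h' | h'
    · exact (h _ _ h').symm
    · exact h _ _ h'

/-- A harmonic function is constant as soon as it grows more slowly than a scale `g` at which
cut-off functions with error of order `1 / g²` exist. -/
theorem IsHarmonic.eq_const_of_isLittleO (hDm : G.FiniteDm) {n : ℝ} (hn : 0 < n)
    (hCDE : G.CDE n 0) {u : V → ℝ} (hu : G.IsHarmonic u) {g : ℝ → ℝ}
    (hg : ∀ R, 0 < R → 0 < g R) (hg2 : ∀ R, 0 < R → g (2 * R) ≤ 2 * g R)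
    {p : V} (hgrowth : (fun R : ℝ => G.maxAbs u p R) =o[atTop] g) {a : ℝ} (ha : 0 ≤ a)
    (hcut : ∀ x₀, ∀ᶠ R in atTop, ∃ φ, G.IsCutoff (a / g R ^ 2) R x₀ φ) :
    ∃ b : ℝ, ∀ x, u x = b := by
  refine ⟨u p, fun x => eq_of_forall_adj_eq (G := G) (fun x₀ y hy => ?_) x p⟩
  -- For `A = a / g R ^ 2` and `M = ε * (2 * g R)`, the factor `A * M ^ 2` is `4 * a * ε ^ 2`.
  set C := 24 * G.m x₀ * (G.Dm * (3 + 3 * n)) * (4 * a) with hC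
  have hD := Dm_nonneg hDm x₀
  have hm := G.m_pos x₀
  have hC0 : 0 ≤ C := by positivity
  have key : ∀ ε : ℝ, 0 < ε → G.μ x₀ y * (u y - u x₀) ^ 2 ≤ C * ε ^ 2 := by
    intro ε hε
    have h2 : Tendsto (fun R : ℝ => 2 * R) atTop atTop :=
      tendsto_id.const_mul_atTop (by norm_num)
    -- Once `R ≥ d(p, x₀) + 2`, the ball `B_{R+2}(x₀)` lies in `B_{2R}(p)`.
    obtain ⟨R, ⟨φ, hφ⟩, hbd, hR⟩ := ((hcut x₀).and ((h2.eventually (hgrowth.bound hε)).and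
      (eventually_ge_atTop ((G.toSimpleGraph.dist p x₀ : ℝ) + 2)))).exists
    have hRpos : 0 < R := by
      have : (0 : ℝ) ≤ G.toSimpleGraph.dist p x₀ := Nat.cast_nonneg _
      linarith
    have hgR := hg R hRpos
    rw [Real.norm_eq_abs, Real.norm_of_nonneg (hg _ (by positivity)).le] at hbd
    have hM : ∀ z ∈ G.ball x₀ (R + 2), |u z| ≤ ε * (2 * g R) := by
      intro z hz
      have hz' : z ∈ G.ball p (2 * R) := by
        have : (G.toSimpleGraph.dist p z : ℝ) ≤
            G.toSimpleGraph.dist p x₀ + G.toSimpleGraph.dist x₀ z := by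
          exact_mod_cast G.connected.dist_triangle
        rw [mem_ball] at *
        linarith
      calc |u z| ≤ G.maxAbs u p (2 * R) := G.abs_le_maxAbs u hz'
        _ ≤ ε * g (2 * R) := (le_abs_self _).trans hbd
        _ ≤ ε * (2 * g R) := by gcongr; exact hg2 R hRpos
    refine (hφ.μ_mul_sq_le hDm hn hCDE hu (by positivity) hRpos.le (by positivity) hM hy).trans
      (le_of_eq ?_)
    rw [hC]
    field_simp
    ring
  have hlim : Tendsto (fun ε : ℝ => C * ε ^ 2) (nhdsWithin 0 (Set.Ioi 0)) (nhds 0) := by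
    have : Tendsto (fun ε : ℝ => C * ε ^ 2) (nhds 0) (nhds (C * 0 ^ 2)) :=
      (continuous_const.mul (continuous_pow 2)).tendsto 0
    simpa using this.mono_left nhdsWithin_le_nhds
  have h0 : G.μ x₀ y * (u y - u x₀) ^ 2 ≤ 0 :=
    ge_of_tendsto hlim (eventually_mem_nhdsWithin.mono fun ε hε => key ε hε)
  have h1 : (u y - u x₀) ^ 2 ≤ 0 := nonpos_of_mul_nonpos_right h0 hy
  have h2 := pow_eq_zero_iff (two_ne_zero) |>.1 (le_antisymm h1 (sq_nonneg _))
  linarith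

/-! ### The two families of cut-offs and the conclusion. -/

/-- The linear cut-off function `max (1 - d(x₀, ·) / R) 0` has error `2 / R`. -/
theorem isCutoff_linear (hDm : G.FiniteDm) (x₀ : V) {R : ℝ} (hR : 0 < R) :
    G.IsCutoff (2 / R) R x₀ fun y => max (1 - (G.toSimpleGraph.dist x₀ y : ℝ) / R) 0 where
  nonneg x := le_max_right _ _
  center := by simp
  support x hx := by
    rw [mem_ball, not_le] at hx
    refine max_eq_right ?_
    rw [sub_nonpos, le_div_iff₀ hR]
    linarith
  bound x _ := by
    set φ : V → ℝ := fun y => max (1 - (G.toSimpleGraph.dist x₀ y : ℝ) / R) 0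
    change φ x ≤ 2 / R ∨ (0 < φ x ∧ (∀ y, 0 < G.μ x y → 0 < φ y) ∧
      φ x ^ 2 * G.laplacian (fun y => 1 / φ y) x ≤ G.Dm * (2 / R))
    rcases le_or_gt (φ x) (2 / R) with h | h
    · exact Or.inl h
    have hRi : 0 < 1 / R := by positivity
    have h2R : 2 / R = 2 * (1 / R) := by ring
    have hstep : ∀ y, 0 < G.μ x y → φ x - 1 / R ≤ φ y := by
      intro y hxy
      have hd : (G.toSimpleGraph.dist x₀ y : ℝ) ≤ G.toSimpleGraph.dist x₀ x + 1 := by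
        exact_mod_cast dist_le_add_one x₀ hxy
      have hd' : (G.toSimpleGraph.dist x₀ y : ℝ) / R ≤
          G.toSimpleGraph.dist x₀ x / R + 1 / R := by
        rw [← add_div]; gcongr
      rw [sub_le_iff_le_add]
      refine max_le ?_ (add_nonneg (le_max_right _ _) hRi.le)
      have : 1 - (G.toSimpleGraph.dist x₀ y : ℝ) / R ≤ φ y := le_max_left _ _
      linarith
    have hpos : 0 < φ x := by linarith
    have hpos' : ∀ y, 0 < G.μ x y → 0 < φ y := fun y hy => by
      have := hstep y hy
      linarith
    refine Or.inr ⟨hpos, hpos', ?_⟩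
    rw [← laplacian_const_mul]
    refine laplacian_le_Dm_mul hDm (by positivity) fun y hy => ?_
    have hφy := hpos' y hy
    have hs := hstep y hy
    -- Since `φ x > 2/R` and an edge costs at most `1/R`, `φ x ≤ 2 φ y`; so the quotient is at most
    -- `2/R`.
    have : φ x ^ 2 * (1 / φ y) - φ x ^ 2 * (1 / φ x) = φ x * (φ x - φ y) / φ y := by
      field_simp
    rw [this, div_le_iff₀ hφy, h2R]
    nlinarith

theorem IsStrongCutoff.isCutoff {c R : ℝ} (hc : 0 < c) {x₀ : V} {φ : V → ℝ}
    (h : G.IsStrongCutoff 0 c R x₀ (G.ball x₀ R) φ) : G.IsCutoff (c / R ^ 2) R x₀ φ where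
  nonneg x := (h.mem_Icc x).1
  center := h.center
  support := h.support
  bound x hx := by
    have hpos : ∀ y, φ y ≠ 0 → 0 < φ y := fun y hy => (h.mem_Icc y).1.lt_of_ne' hy
    rcases h.bound x hx with h1 | ⟨⟨h1, h2⟩, h3, -⟩
    · left
      have : c * (1 + R * √0) / (2 * R ^ 2) = c / R ^ 2 / 2 := by
        rw [Real.sqrt_zero, div_div]; ring
      have h0 : 0 ≤ c / R ^ 2 := by positivity
      linarith
    · refine Or.inr ⟨hpos x h1, fun y hy => hpos y (h2 y hy), ?_⟩
      simpa using h3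

end WeightedGraph

theorem mainTheorem4 {V : Type*} (G : WeightedGraph V) (hDm : G.FiniteDm)
    (n : ℝ) (hn : 0 < n) (hCDE : G.CDE n 0) :
    (∀ u : V → ℝ, G.IsHarmonic u → G.SubSqrtGrowth u → ∃ a : ℝ, ∀ x, u x = a) ∧
    (G.FiniteDμ → G.HasStrongCutoffs →
      ∀ u : V → ℝ, G.IsHarmonic u → G.SublinearGrowth u → ∃ a : ℝ, ∀ x, u x = a) := by
  constructor
  · rintro u hu ⟨p, hp⟩
    simp only [← Real.sqrt_eq_rpow] at hp
    refine hu.eq_const_of_isLittleO hDm hn hCDE (fun R hR => Real.sqrt_pos.2 hR)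
      (fun R hR => ?_) hp (a := 2) (by norm_num) fun x₀ => ?_
    · rw [Real.sqrt_le_left (by positivity), mul_pow, Real.sq_sqrt hR.le]
      linarith
    · filter_upwards [eventually_gt_atTop 0] with R hR
      rw [Real.sq_sqrt hR.le]
      exact ⟨_, WeightedGraph.isCutoff_linear hDm x₀ hR⟩
  · rintro - ⟨c, hc, hcut⟩ u hu ⟨p, hp⟩
    refine hu.eq_const_of_isLittleO hDm hn hCDE (g := fun R => R) (fun R hR => hR)
      (fun R _ => le_rfl) hp hc.le fun x₀ => ?_
    obtain ⟨R₀, hR₀⟩ := hcut x₀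
    filter_upwards [eventually_ge_atTop R₀] with R hR
    obtain ⟨φ, hφ⟩ := hR₀ R hR
    exact ⟨φ, hφ.isCutoff hc⟩
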